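/- Let $k \ge 2$ be an integer and let $G$ be a (finite simple) graph of order $n \ge 2k+1$ with minimum degree $\delta(G) \ge k$. Let $\overline{G}$ be the complement of $G$ and let $\mu(\overline{G})$ be its spectral radius, i.e. the largest eigenvalue of its adjacency matrix. Suppose that $$\mu(\overline{G}) \le \sqrt{k(n-k-1)}.$$ Then $G$ is traceable from every vertex, i.e. for every vertex $x$ of $G$ there is a Hamiltonian path of $G$ with $x$ as an endpoint, unless (up to isomorphism) $G = (K_k + K_{n-k-1}) \vee K_1$, or $n = 2k+1$ and $G \in EW_n$. Here $+$ denotes the disjoint union of graphs, and $G_1 \vee G_2$ denotes the join, i.e. the disjoint union of $G_1$ and $G_2$ together with all edges between $V(G_1)$ and $V(G_2)$. For odd $n$, $EW_n$ is the set of all graphs of the form $G_1 \vee G_2$ for which there is an integer $r$ with $1 \le r \le \frac{n+1}{2}$ such that $G_1$ is a regular graph of order $n+1-r$ and degree $\frac{n+1}{2}-r$, and $G_2$ is any graph with $r-1$ vertices (with no vertices, so that the join is $G_1$, if $r=1$). ("Unless" means that at least one of the alternatives holds; it is not claimed that every graph in $EW_n$ fails to be traceable from every vertex.) -/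

import Mathlib

/-- The spectral radius `μ(G)` of a finite graph: the largest eigenvalue of its (real symmetric)
adjacency matrix. -/
noncomputable def graphSpectralRadius {V : Type*} [Fintype V] [DecidableEq V]
    (G : SimpleGraph V) [DecidableRel G.Adj] : ℝ :=
  sSup {x : ℝ | Module.End.HasEigenvalue (Matrix.toLin' (G.adjMatrix ℝ)) x}

/-- The join `G ∨ H` of two graphs on disjoint vertex sets: the disjoint union together with all
edges between the two parts. -/
def graphJoin {V W : Type*} (G : SimpleGraph V) (H : SimpleGraph W) : SimpleGraph (V ⊕ W) where
  Adj
    | .inl u, .inl v => G.Adj u v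
    | .inr u, .inr v => H.Adj u v
    | .inl _, .inr _ => True
    | .inr _, .inl _ => True
  symm := ⟨by
    rintro (u | u) (v | v) h
    · exact G.adj_symm h
    · trivial
    · trivial
    · exact H.adj_symm h⟩
  loopless := ⟨by
    rintro (u | u) h
    · exact G.irrefl h
    · exact H.irrefl h⟩

/-- `G` is traceable from the vertex `x`: some Hamiltonian path of `G` starts at `x`. -/
def TraceableFrom {V : Type*} [DecidableEq V] (G : SimpleGraph V) (x : V) : Prop :=
  ∃ (y : V) (p : G.Walk x y), p.IsHamiltonian

/-- `G` is traceable from every vertex. -/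
def TraceableFromEveryVertex {V : Type*} [DecidableEq V] (G : SimpleGraph V) : Prop :=
  ∀ x : V, TraceableFrom G x

/-- `G` belongs (up to isomorphism) to the family `EW_n`, for odd `n`: it is a join `G₁ ∨ G₂` where,
for some `1 ≤ r ≤ (n+1)/2`, the graph `G₁` is regular of degree `(n+1)/2 - r` on `n + 1 - r`
vertices and `G₂` is an arbitrary graph on `r - 1` vertices (no vertices if `r = 1`). -/
def IsEW (n : ℕ) {V : Type*} (G : SimpleGraph V) : Prop :=
  Odd n ∧ ∃ r : ℕ, 1 ≤ r ∧ r ≤ (n + 1) / 2 ∧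
    ∃ (G₁ : SimpleGraph (Fin (n + 1 - r))) (_ : G₁.LocallyFinite)
      (G₂ : SimpleGraph (Fin (r - 1))),
      G₁.IsRegularOfDegree ((n + 1) / 2 - r) ∧ Nonempty (G ≃g graphJoin G₁ G₂)

/-!
Suppose `G` is not traceable from some vertex `x`, and let `H` be an edge-maximal supergraph of `G`
that is not traceable from `x`; write `M` for the complement of `H`. Rotating a Hamiltonian path
shows that adding an edge between two vertices of degree sum at least `n` cannot create traceability
from `x` (`TraceableFrom.of_sup_edge`), so by maximality `d(u) + d(v) ≥ n - 1` for the `M`-degrees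
along every edge `uv` of `M`. Complete graphs are traceable, so `M` has an edge, and `δ(G) ≥ k` gives
`d ≤ n - 1 - k`; hence `d(u) d(v) ≥ k (n - k - 1)` on every edge.

If `n = 2 k + 1`, the degree conditions alone force `d(u) = k` for every vertex `u` that is not
isolated in `M`. Such a `u` has no further non-neighbours in `G`, so the non-isolated vertices of `M`
induce a regular graph in `G` joined to all the rest, and `G` is in `EW`.

If `n > 2 k + 1`, test the adjacency matrix of the complement of `G` on the vector `v ↦ √d(v)`. The
bound on the spectral radius forces equality throughout
(`sqrt_degree_mul_eq_of_graphSpectralRadius_le`): the two ends of each edge of `M` have degrees `k`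
and `n - k - 1`, and any edge of the complement of `G` outside `M` joins two isolated vertices of
`M`. Double counting then makes `M` the graph `K_{n-k-1,k}` with one isolated vertex
(`exists_completeBipartite_of_degrees`). A single isolated vertex leaves no room for more edges, so
`M` is the complement of `G`, which is therefore `(K_k + K_{n-k-1}) ∨ K_1`.
-/

/-! ### Hamiltonian paths as sequences of vertices -/

/-- `f 0, …, f (n - 1)` are distinct vertices, consecutive ones adjacent, starting at `x`. For
`n = Fintype.card V` this is a Hamiltonian path from `x`; the values `f t` with `n ≤ t` are
irrelevant. -/
structure IsPathSeq {V : Type*} (G : SimpleGraph V) (x : V) (n : ℕ) (f : ℕ → V) : Prop where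
  zero : f 0 = x
  inj : Set.InjOn f (Set.Iio n)
  adj : ∀ t, t + 1 < n → G.Adj (f t) (f (t + 1))

/-- The first `m + 1` terms of a sequence of successively adjacent vertices form a walk. -/
lemma exists_walk_support_eq_map_range {V : Type*} {G : SimpleGraph V} {f : ℕ → V} (m : ℕ)
    (h : ∀ t < m, G.Adj (f t) (f (t + 1))) :
    ∃ p : G.Walk (f 0) (f m), p.support = (List.range (m + 1)).map f := by
  induction m with
  | zero => exact ⟨.nil, by simp⟩
  | succ m ih =>
    obtain ⟨p, hp⟩ := ih fun t ht => h t (by omega)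
    refine ⟨p.concat (h m (by omega)), ?_⟩
    rw [SimpleGraph.Walk.support_concat, hp, List.range_succ (n := m + 1)]
    simp

/-- The rotation step: if the only missing edge of the path `f` is `f i, f (i + 1)`, then
reversing a segment `a, …, b` one of whose ends is at that gap repairs the path, provided that the
two new junctions are edges. -/
lemma IsPathSeq.reverse_segment {V : Type*} {G : SimpleGraph V} {n i a b : ℕ} {f : ℕ → V}
    (hinj : Set.InjOn f (Set.Iio n))
    (hadj : ∀ t, t + 1 < n → t ≠ i → G.Adj (f t) (f (t + 1)))
    (ha : 0 < a) (hab : a ≤ b) (hb : b < n) (hi : i + 1 = a ∨ i = b)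
    (h1 : G.Adj (f (a - 1)) (f b)) (h2 : b + 1 < n → G.Adj (f a) (f (b + 1))) :
    IsPathSeq G (f 0) n (fun t => f (if a ≤ t ∧ t ≤ b then a + b - t else t)) where
  zero := by
    rw [if_neg (by omega)]
  inj := by
    intro s hs t ht hst
    simp only [Set.mem_Iio] at hs ht
    have := hinj (by simp only [Set.mem_Iio]; split_ifs <;> omega)
      (by simp only [Set.mem_Iio]; split_ifs <;> omega) hst
    split_ifs at this <;> omega
  adj := by
    intro t ht
    rcases lt_trichotomy (t + 1) a with h | h | h
    · rw [if_neg (by omega), if_neg (by omega)]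
      exact hadj t ht (by omega)
    · rw [if_neg (by omega), if_pos (by omega), show a + b - (t + 1) = b by omega,
        show t = a - 1 by omega]
      exact h1
    · rcases lt_trichotomy t b with h' | h' | h'
      · rw [if_pos (by omega), if_pos (by omega),
          show a + b - t = a + b - (t + 1) + 1 by omega]
        exact (hadj _ (by omega) (by omega)).symm
      · subst h'
        rw [if_pos (by omega), if_neg (by omega), show a + t - t = a by omega]
        exact h2 ht
      · rw [if_neg (by omega), if_neg (by omega)]
        exact hadj t ht (by omega)

section Trace

variable {V : Type*} [Fintype V] [DecidableEq V]

lemma traceableFrom_iff_exists_isPathSeq {G : SimpleGraph V} {x : V} :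
    TraceableFrom G x ↔ ∃ f, IsPathSeq G x (Fintype.card V) f := by
  have hpos : 0 < Fintype.card V := Fintype.card_pos_iff.2 ⟨x⟩
  constructor
  · rintro ⟨y, p, hp⟩
    have hl := hp.length_eq
    refine ⟨p.getVert, p.getVert_zero, fun a ha b hb hab => ?_, fun t ht => ?_⟩
    · simp only [Set.mem_Iio] at ha hb
      exact hp.isPath.getVert_injOn (by simp only [Set.mem_ofPred_eq]; omega)
        (by simp only [Set.mem_ofPred_eq]; omega) hab
    · exact p.adj_getVert_succ (by omega)
  · rintro ⟨f, rfl, hinj, hadj⟩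
    obtain ⟨m, hm⟩ : ∃ m, Fintype.card V = m + 1 := ⟨_, (Nat.sub_add_cancel hpos).symm⟩
    rw [hm] at hinj hadj
    obtain ⟨p, hp⟩ := exists_walk_support_eq_map_range m fun t ht => hadj t (by omega)
    have hnd : p.support.Nodup := by
      rw [hp]
      refine List.Nodup.map_on (fun a ha b hb hab => ?_) List.nodup_range
      exact hinj (List.mem_range.1 ha) (List.mem_range.1 hb) hab
    refine ⟨_, p, (SimpleGraph.Walk.IsPath.mk' hnd).isHamiltonian_of_mem fun w => ?_⟩
    have hcard : p.support.toFinset.card = Fintype.card V := by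
      rw [List.toFinset_card_of_nodup hnd, hp, hm]; simp
    rw [← List.mem_toFinset, Finset.card_eq_iff_eq_univ _ |>.1 hcard]
    exact Finset.mem_univ w

/-- A Hamiltonian path in which one consecutive pair fails to be an edge can be repaired by a
rotation when the degree sum of that pair is at least the order of the graph. -/
lemma traceableFrom_of_gap {G : SimpleGraph V} [DecidableRel G.Adj] {i : ℕ} {f : ℕ → V}
    (hinj : Set.InjOn f (Set.Iio (Fintype.card V))) (hi : i + 1 < Fintype.card V)
    (hadj : ∀ t, t + 1 < Fintype.card V → t ≠ i → G.Adj (f t) (f (t + 1)))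
    (hdeg : Fintype.card V ≤ G.degree (f i) + G.degree (f (i + 1))) :
    TraceableFrom G (f 0) := by
  by_cases hgap : G.Adj (f i) (f (i + 1))
  · exact traceableFrom_iff_exists_isPathSeq.2 ⟨f, rfl, hinj, fun t ht => by
      by_cases h : t = i
      · exact h ▸ hgap
      · exact hadj t ht h⟩
  by_contra hnot
  set n := Fintype.card V with hn
  have hrot : ∀ a b, 0 < a → a ≤ b → b < n → (i + 1 = a ∨ i = b) → G.Adj (f (a - 1)) (f b) →
      (b + 1 < n → G.Adj (f a) (f (b + 1))) → False := fun a b h0 h1 h2 h3 h4 h5 =>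
    hnot (traceableFrom_iff_exists_isPathSeq.2 ⟨_, .reverse_segment hinj hadj h0 h1 h2 h3 h4 h5⟩)
  have himg : (Finset.range n).image f = Finset.univ := by
    rw [← Finset.card_eq_iff_eq_univ, Finset.card_image_of_injOn, Finset.card_range]
    exact fun a ha b hb => hinj (by simpa using ha) (by simpa using hb)
  have hcount : ∀ w, ((Finset.range n).filter fun t => G.Adj w (f t)).card = G.degree w := by
    intro w
    rw [← G.card_neighborFinset_eq_degree]
    refine Finset.card_bij (fun t _ => f t) (by simp) (fun a ha b hb => hinj ?_ ?_) fun v hv => ?_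
    · simpa using (Finset.mem_filter.1 ha).1
    · simpa using (Finset.mem_filter.1 hb).1
    · obtain ⟨t, ht, rfl⟩ := Finset.mem_image.1 (himg ▸ Finset.mem_univ v)
      exact ⟨t, by simpa using ⟨by simpa using ht, by simpa using hv⟩, rfl⟩
  set I := (Finset.range n).filter fun t => G.Adj (f i) (f t) with hI
  set J := (Finset.range n).filter fun t => G.Adj (f (i + 1)) (f t) with hJ
  have hlast : ∀ t ∈ I, t + 1 < n := by
    intro t ht
    simp only [hI, Finset.mem_filter, Finset.mem_range] at ht
    by_contra h
    -- `f i` is adjacent to the last vertex: reverse everything after the gap.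
    rcases lt_or_ge t (i + 1) with h' | h'
    · omega
    · exact hrot (i + 1) t (by omega) h' ht.1 (.inl rfl) (by simpa using ht.2) (by omega)
  have hdisj : Disjoint J (I.image (· + 1)) := by
    rw [Finset.disjoint_left]
    intro s hs hs'
    obtain ⟨t, ht, rfl⟩ := Finset.mem_image.1 hs'
    have htn := hlast t ht
    simp only [hI, hJ, Finset.mem_filter, Finset.mem_range] at hs ht
    have hti : t ≠ i := fun h => by subst h; exact G.irrefl ht.2
    have hti' : t ≠ i + 1 := fun h => by subst h; exact hgap ht.2
    rcases lt_or_ge t i with h | h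
    · exact hrot (t + 1) i (by omega) h (by omega) (.inr rfl) (by simpa using ht.2.symm)
        fun _ => hs.2.symm
    · exact hrot (i + 1) t (by omega) (by omega) ht.1 (.inl rfl) (by simpa using ht.2)
        fun _ => hs.2
  have hnotin : i + 1 ∉ J ∪ I.image (· + 1) := by
    simp [hI, hJ]
  have hsub : insert (i + 1) (J ∪ I.image (· + 1)) ⊆ Finset.range n := by
    intro s hs
    simp only [Finset.mem_insert, Finset.mem_union, Finset.mem_image] at hs
    rcases hs with rfl | hs | ⟨t, ht, rfl⟩
    · simpa using hi
    · exact (Finset.mem_filter.1 hs).1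
    · simpa using hlast t ht
  have hle := Finset.card_le_card hsub
  rw [Finset.card_insert_of_notMem hnotin, Finset.card_union_of_disjoint hdisj,
    Finset.card_image_of_injective _ (add_left_injective 1), Finset.card_range, hcount, hcount]
    at hle
  omega

/-- Bondy–Chvátal stability of traceability from `x`: adding an edge between two vertices of degree
sum at least the order of the graph does not change whether the graph is traceable from `x`. -/
lemma TraceableFrom.of_sup_edge {G : SimpleGraph V} [DecidableRel G.Adj] {x u v : V}
    (hdeg : Fintype.card V ≤ G.degree u + G.degree v)
    (h : TraceableFrom (G ⊔ SimpleGraph.edge u v) x) : TraceableFrom G x := by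
  obtain ⟨f, rfl, hinj, hadj⟩ := traceableFrom_iff_exists_isPathSeq.1 h
  simp only [SimpleGraph.sup_adj, SimpleGraph.edge_adj] at hadj
  by_cases hall : ∀ t, t + 1 < Fintype.card V → G.Adj (f t) (f (t + 1))
  · exact traceableFrom_iff_exists_isPathSeq.2 ⟨f, rfl, hinj, hall⟩
  push Not at hall
  obtain ⟨i, hi, hgap⟩ := hall
  have hiuv := (hadj i hi).resolve_left hgap
  refine traceableFrom_of_gap (i := i) hinj hi (fun t ht hti => ?_) ?_
  · refine (hadj t ht).resolve_right fun htuv => hti ?_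
    have e : ∀ a < Fintype.card V, ∀ b < Fintype.card V, f a = f b → a = b :=
      fun a ha b hb hab => hinj ha hb hab
    rcases htuv.1 with ⟨h1, h2⟩ | ⟨h1, h2⟩ <;> rcases hiuv.1 with ⟨h3, h4⟩ | ⟨h3, h4⟩
    · exact e _ (by omega) _ (by omega) (h1.trans h3.symm)
    · have := e _ (by omega) _ (by omega) (h1.trans h4.symm)
      have := e _ (by omega) _ (by omega) (h2.trans h3.symm)
      omega
    · have := e _ (by omega) _ (by omega) (h1.trans h4.symm)
      have := e _ (by omega) _ (by omega) (h2.trans h3.symm)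
      omega
    · exact e _ (by omega) _ (by omega) (h1.trans h3.symm)
  · rcases hiuv.1 with ⟨h3, h4⟩ | ⟨h3, h4⟩ <;> rw [h3, h4] <;> omega

end Trace

/-! ### The spectral radius and equality in Rayleigh's inequality -/

section Spectral

variable {V : Type*} [Fintype V] [DecidableEq V]

lemma le_graphSpectralRadius (B : SimpleGraph V) [DecidableRel B.Adj] {x : ℝ}
    (hx : Module.End.HasEigenvalue (Matrix.toLin' (B.adjMatrix ℝ)) x) :
    x ≤ graphSpectralRadius B :=
  le_csSup (Module.End.finite_hasEigenvalue _).bddAbove hx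

lemma posSemidef_smul_one_sub_adjMatrix (B : SimpleGraph V) [DecidableRel B.Adj] {c : ℝ}
    (hc : graphSpectralRadius B ≤ c) :
    (c • (1 : Matrix V V ℝ) - B.adjMatrix ℝ).PosSemidef := by
  rw [Matrix.posSemidef_iff_isHermitian_and_spectrum_nonneg]
  constructor
  · exact (Matrix.isHermitian_one.smul (IsSelfAdjoint.all c)).sub
      (by rw [Matrix.IsHermitian, Matrix.conjTranspose_eq_transpose_of_trivial]
          exact B.transpose_adjMatrix)
  · intro s hs
    rw [← Algebra.algebraMap_eq_smul_one, ← spectrum.singleton_sub_eq] at hs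
    obtain ⟨_, rfl, t, ht, rfl⟩ := hs
    rw [← Matrix.spectrum_toLin', ← Module.End.hasEigenvalue_iff_mem_spectrum] at ht
    exact sub_nonneg.2 ((le_graphSpectralRadius B ht).trans hc)

/-- A nonnegative vector `y` with `c y ≤ B y` entrywise, where `c` is at least the spectral radius
of `B`, is an eigenvector for `c`. -/
lemma sum_neighborFinset_eq_of_le (B : SimpleGraph V) [DecidableRel B.Adj] {c : ℝ}
    (hc : graphSpectralRadius B ≤ c) {y : V → ℝ} (hy : ∀ v, 0 ≤ y v)
    (hle : ∀ v, c * y v ≤ ∑ w ∈ B.neighborFinset v, y w) (v : V) :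
    ∑ w ∈ B.neighborFinset v, y w = c * y v := by
  have hP := posSemidef_smul_one_sub_adjMatrix B hc
  have happ : ∀ v, ((c • (1 : Matrix V V ℝ) - B.adjMatrix ℝ).mulVec y) v
      = c * y v - ∑ w ∈ B.neighborFinset v, y w := fun v => by
    simp [Matrix.sub_mulVec, Matrix.smul_mulVec]
  have h0 : dotProduct (star y) ((c • (1 : Matrix V V ℝ) - B.adjMatrix ℝ).mulVec y) = 0 := by
    refine le_antisymm (Finset.sum_nonpos fun v _ => ?_) (hP.dotProduct_mulVec_nonneg y)
    rw [happ]
    exact mul_nonpos_of_nonneg_of_nonpos (hy v) (sub_nonpos.2 (hle v))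
  have := congrFun ((hP.dotProduct_mulVec_zero_iff y).1 h0) v
  rw [happ] at this
  simp only [Pi.zero_apply] at this
  linarith

/-- If every edge `uv` of a subgraph `M ≤ B` satisfies `c ≤ √(d(u) d(v))`, with degrees in `M` and
`c` at least the spectral radius of `B`, then equality holds on every edge and the edges of `B`
outside `M` join isolated vertices of `M`. The test vector is `v ↦ √d(v)`. -/
lemma sqrt_degree_mul_eq_of_graphSpectralRadius_le {M B : SimpleGraph V} [DecidableRel M.Adj]
    [DecidableRel B.Adj] (hMB : M ≤ B) {c : ℝ} (hc : graphSpectralRadius B ≤ c)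
    (hM : ∀ u v, M.Adj u v → c ≤ √(M.degree u) * √(M.degree v)) :
    (∀ u v, M.Adj u v → √(M.degree u) * √(M.degree v) = c) ∧
      ∀ u v, B.Adj u v → ¬ M.Adj u v → M.degree u = 0 := by
  set y : V → ℝ := fun v => √(M.degree v) with hydef
  have hy : ∀ v, 0 ≤ y v := fun v => Real.sqrt_nonneg _
  have hpos : ∀ {v}, M.degree v ≠ 0 → 0 < y v := fun h =>
    Real.sqrt_pos.2 (by exact_mod_cast Nat.pos_of_ne_zero h)
  have hsub : ∀ v, M.neighborFinset v ⊆ B.neighborFinset v := fun v w hw => by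
    simp only [SimpleGraph.mem_neighborFinset] at hw ⊢
    exact hMB hw
  have hdeg : ∀ {u v}, M.Adj u v → M.degree u ≠ 0 := fun {u v} h =>
    ((M.degree_pos_iff_exists_adj u).2 ⟨v, h⟩).ne'
  have hconst : ∀ v, ∑ _w ∈ M.neighborFinset v, c / y v = c * y v := fun v => by
    rw [Finset.sum_const, M.card_neighborFinset_eq_degree, nsmul_eq_mul, mul_div_left_comm]
    simp only [hydef, Real.div_sqrt]
  have hterm : ∀ v, ∀ w ∈ M.neighborFinset v, c / y v ≤ y w := fun v w hw => by
    have hvw := (M.mem_neighborFinset v w).1 hw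
    rw [div_le_iff₀ (hpos (hdeg hvw)), mul_comm]
    exact hM v w hvw
  have hM_le : ∀ v, c * y v ≤ ∑ w ∈ M.neighborFinset v, y w := fun v =>
    (hconst v).symm.le.trans (Finset.sum_le_sum (hterm v))
  have hB_le : ∀ v, ∑ w ∈ M.neighborFinset v, y w ≤ ∑ w ∈ B.neighborFinset v, y w := fun v =>
    Finset.sum_le_sum_of_subset_of_nonneg (hsub v) fun w _ _ => hy w
  have heig := sum_neighborFinset_eq_of_le B hc hy fun v => (hM_le v).trans (hB_le v)
  have hMsum : ∀ v, ∑ w ∈ M.neighborFinset v, y w = c * y v := fun v =>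
    le_antisymm ((hB_le v).trans (heig v).le) (hM_le v)
  constructor
  · intro u v huv
    have := (Finset.sum_eq_sum_iff_of_le (hterm u)).1 ((hconst u).trans (hMsum u).symm) v
      ((M.mem_neighborFinset u v).2 huv)
    rw [div_eq_iff (hpos (hdeg huv)).ne'] at this
    rw [this, mul_comm]
  · intro u v huv hnot
    have h := Finset.sum_sdiff (f := y) (hsub v)
    rw [heig, hMsum, add_eq_right, Finset.sum_eq_zero_iff_of_nonneg fun w _ => hy w] at h
    by_contra hd
    refine (hpos hd).ne' (h u ?_)
    simpa using ⟨huv.symm, fun h' => hnot h'.symm⟩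

end Spectral

/-! ### The complement of an edge-maximal non-traceable graph -/

section Maximal

variable {V : Type*} [Fintype V] [DecidableEq V]

lemma traceableFrom_top (x : V) : TraceableFrom (⊤ : SimpleGraph V) x := by
  have hpos : 0 < Fintype.card V := Fintype.card_pos_iff.2 ⟨x⟩
  let e := (Fintype.equivFin V).trans (Equiv.swap (Fintype.equivFin V x) ⟨0, hpos⟩)
  have hinj : Set.InjOn (fun t => if h : t < Fintype.card V then e.symm ⟨t, h⟩ else x)
      (Set.Iio (Fintype.card V)) := by
    intro a ha b hb hab
    simp only [Set.mem_Iio] at ha hb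
    simpa [ha, hb] using hab
  refine traceableFrom_iff_exists_isPathSeq.2 ⟨_, ?_, hinj, fun t ht => ?_⟩
  · simp [hpos, e]
  · rw [SimpleGraph.top_adj]
    intro h
    have := hinj (by simp only [Set.mem_Iio]; omega) (by simp only [Set.mem_Iio]; omega) h
    omega

/-- If `G` is not traceable from `x`, the complement `M` of an edge-maximal supergraph with this
property is a nonempty subgraph of the complement of `G` in which the degree sum over every edge is
at least `n - 1`. -/
lemma exists_le_compl_of_not_traceableFrom {G : SimpleGraph V} {x : V}
    (hG : ¬ TraceableFrom G x) :
    ∃ (M : SimpleGraph V) (_ : DecidableRel M.Adj), M ≤ Gᶜ ∧ (∃ u v, M.Adj u v) ∧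
      ∀ u v, M.Adj u v → Fintype.card V ≤ M.degree u + M.degree v + 1 := by
  classical
  obtain ⟨H, hGH, hH, hmax⟩ :=
    Finite.exists_le_maximal (p := fun H : SimpleGraph V => ¬ TraceableFrom H x) hG
  refine ⟨Hᶜ, inferInstance, compl_le_compl hGH, ?_, fun u v huv => ?_⟩
  · by_contra hno
    push Not at hno
    refine hH ?_
    rw [show H = ⊤ from compl_eq_bot.1 (by ext u v; simpa using hno u v)]
    exact traceableFrom_top x
  · by_contra hlt
    rw [SimpleGraph.compl_adj] at huv
    have hu := H.degree_compl (v := u)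
    have hv := H.degree_compl (v := v)
    have hu' := H.degree_lt_card_verts u
    have hv' := H.degree_lt_card_verts v
    have hT : TraceableFrom (H ⊔ SimpleGraph.edge u v) x := by
      by_contra hT
      have := hmax hT le_sup_left (show (H ⊔ SimpleGraph.edge u v).Adj u v by
        simp [SimpleGraph.edge_adj, huv.1])
      exact huv.2 this
    exact hH (hT.of_sup_edge (by omega))

end Maximal

/-! ### The family `EW` -/

section EW

variable {V : Type*} [Fintype V] [DecidableEq V]

/-- A graph on `2 k + 1` vertices is in `EW` as soon as it has a set `S` of more than `k` vertices of
degree `k`, each adjacent to everything outside `S`. -/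
lemma isEW_of_forall_degree_eq {G : SimpleGraph V} [DecidableRel G.Adj] {n k : ℕ}
    (hcard : Fintype.card V = n) (hn : n = 2 * k + 1) (S : Finset V) (hS : k + 1 ≤ S.card)
    (hdeg : ∀ s ∈ S, G.degree s = k) (hadj : ∀ s ∈ S, ∀ t ∉ S, G.Adj s t) : IsEW n G := by
  have hSn : S.card ≤ n := hcard ▸ S.card_le_univ
  refine ⟨⟨k, hn⟩, n + 1 - S.card, by omega, by omega, ?_⟩
  have hSc : (Sᶜ).card = n - S.card := by rw [Finset.card_compl, hcard]
  let e₁ : Fin (n + 1 - (n + 1 - S.card)) ≃ S :=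
    (finCongr (by omega)).trans S.equivFin.symm
  let e₂ : Fin (n + 1 - S.card - 1) ≃ (Sᶜ : Finset V) :=
    (finCongr (by omega)).trans (Sᶜ).equivFin.symm
  have h₁ : ∀ i, (e₁ i : V) ∈ S := fun i => (e₁ i).2
  have h₂ : ∀ i, (e₂ i : V) ∉ S := fun i => Finset.mem_compl.1 (e₂ i).2
  refine ⟨G.comap fun i => (e₁ i : V), fun _ => Fintype.ofFinite _,
    G.comap fun i => (e₂ i : V), fun i => ?_, ⟨SimpleGraph.Iso.symm ⟨?_, ?_⟩⟩⟩
  · have hsplit : (G.neighborFinset (e₁ i) ∩ S).card + (Sᶜ).card = k := by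
      rw [← hdeg _ (h₁ i), ← G.card_neighborFinset_eq_degree,
        ← Finset.card_inter_add_card_sdiff (G.neighborFinset (e₁ i)) S]
      congr 2
      ext t
      simp only [Finset.mem_compl, Finset.mem_sdiff, SimpleGraph.mem_neighborFinset]
      exact ⟨fun h => ⟨hadj _ (h₁ i) _ h, h⟩, fun h => h.2⟩
    have hbij : ((G.comap fun i => (e₁ i : V)).neighborFinset i).card
        = (G.neighborFinset (e₁ i) ∩ S).card := by
      refine Finset.card_bij (fun j _ => (e₁ j : V)) (fun j hj => ?_) (fun a _ b _ h => ?_)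
        fun t ht => ?_
      · simpa [h₁] using hj
      · exact e₁.injective (Subtype.ext h)
      · obtain ⟨ht, htS⟩ := Finset.mem_inter.1 ht
        exact ⟨e₁.symm ⟨t, htS⟩, by simpa using ht, by simp⟩
    rw [SimpleGraph.card_neighborFinset_eq_degree] at hbij
    trans (G.neighborFinset (e₁ i) ∩ S).card
    · convert hbij
    · omega
  · refine Equiv.ofBijective (Sum.elim (fun i => (e₁ i : V)) fun i => (e₂ i : V)) ?_
    rw [Fintype.bijective_iff_injective_and_card]
    constructor
    · rintro (a | a) (b | b) h <;> simp only [Sum.elim_inl, Sum.elim_inr] at h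
      · rw [e₁.injective (Subtype.ext h)]
      · exact (h₂ b (h ▸ h₁ a)).elim
      · exact (h₂ a (h ▸ h₁ b)).elim
      · rw [e₂.injective (Subtype.ext h)]
    · simp only [Fintype.card_sum, Fintype.card_fin]
      omega
  · rintro (a | a) (b | b)
    · exact Iff.rfl
    · exact iff_of_true (hadj _ (h₁ a) _ (h₂ b)) trivial
    · exact iff_of_true (hadj _ (h₁ b) _ (h₂ a)).symm trivial
    · exact Iff.rfl

end EW

/-! ### Complete bipartite complements -/

section Bipartite

variable {V : Type*} [Fintype V] [DecidableEq V]

/-- If `m > k > 0` and every edge of a graph on `m + k + 1` vertices joins a vertex of degree `k` to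
one of degree `m`, then the graph is empty or `K_{m,k}` with one isolated vertex. -/
lemma exists_completeBipartite_of_degrees {M : SimpleGraph V} [DecidableRel M.Adj] {k m : ℕ}
    (hk : 0 < k) (hkm : k < m) (hcard : Fintype.card V = m + k + 1) (hne : ∃ u v, M.Adj u v)
    (hM : ∀ u v, M.Adj u v →
      M.degree u = k ∧ M.degree v = m ∨ M.degree u = m ∧ M.degree v = k) :
    ∃ (A C : Finset V) (w : V), A.card = m ∧ C.card = k ∧ Disjoint A C ∧ w ∉ A ∧ w ∉ C ∧
      (∀ z, M.degree z = 0 → z = w) ∧ ∀ u v, M.Adj u v ↔ u ∈ A ∧ v ∈ C ∨ u ∈ C ∧ v ∈ A := by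
  set A := Finset.univ.filter fun v => M.degree v = k with hA
  set C := Finset.univ.filter fun v => M.degree v = m with hC
  have hAmem : ∀ v, v ∈ A ↔ M.degree v = k := by simp [hA]
  have hCmem : ∀ v, v ∈ C ↔ M.degree v = m := by simp [hC]
  have hNA : ∀ a ∈ A, M.neighborFinset a ⊆ C := fun a ha v hv => by
    have := hM a v (by simpa using hv)
    rw [hAmem] at ha
    rw [hCmem]
    omega
  have hNC : ∀ c ∈ C, M.neighborFinset c ⊆ A := fun c hc v hv => by
    have := hM c v (by simpa using hv)
    rw [hCmem] at hc
    rw [hAmem]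
    omega
  have hNAcard : ∀ a ∈ A, (M.neighborFinset a).card = k := fun a ha => by
    rw [M.card_neighborFinset_eq_degree, (hAmem a).1 ha]
  have hNCcard : ∀ c ∈ C, (M.neighborFinset c).card = m := fun c hc => by
    rw [M.card_neighborFinset_eq_degree, (hCmem c).1 hc]
  have hdisj : Disjoint A C := Finset.disjoint_left.2 fun v h1 h2 => by
    rw [hAmem] at h1
    rw [hCmem] at h2
    omega
  have hcount : A.card * k = C.card * m := by
    refine Finset.card_mul_eq_card_mul M.Adj (fun a ha => ?_) fun c hc => ?_
    · rw [← hNAcard a ha]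
      congr 1
      ext v
      simp only [Finset.mem_bipartiteAbove, SimpleGraph.mem_neighborFinset]
      exact ⟨fun h => h.2, fun h => ⟨hNA a ha (by simpa using h), h⟩⟩
    · rw [← hNCcard c hc]
      congr 1
      ext v
      simp only [Finset.mem_bipartiteBelow, SimpleGraph.mem_neighborFinset]
      exact ⟨fun h => h.2.symm, fun h => ⟨hNC c hc (by simpa using h), h.symm⟩⟩
  obtain ⟨a, ha, c, hc⟩ : ∃ a ∈ A, ∃ c, c ∈ C := by
    obtain ⟨u, v, huv⟩ := hne
    rcases hM u v huv with ⟨h1, h2⟩ | ⟨h1, h2⟩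
    · exact ⟨u, (hAmem u).2 h1, v, (hCmem v).2 h2⟩
    · exact ⟨v, (hAmem v).2 h2, u, (hCmem u).2 h1⟩
  have hC_ge : k ≤ C.card := (hNAcard a ha) ▸ Finset.card_le_card (hNA a ha)
  have hA_ge : m ≤ A.card := (hNCcard c hc) ▸ Finset.card_le_card (hNC c hc)
  have hsum : A.card + C.card ≤ m + k + 1 := by
    rw [← Finset.card_union_of_disjoint hdisj, ← hcard]
    exact Finset.card_le_univ _
  -- One spare vertex is left; giving it to either side would unbalance `|A| k = |C| m`.
  have hAC : A.card = m ∧ C.card = k := by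
    have hcases : (A.card = m ∧ C.card = k) ∨ (A.card = m + 1 ∧ C.card = k) ∨
        (A.card = m ∧ C.card = k + 1) := by omega
    rcases hcases with h | ⟨h1, h2⟩ | ⟨h1, h2⟩
    · exact h
    · rw [h1, h2] at hcount
      exact absurd hcount (by nlinarith)
    · rw [h1, h2] at hcount
      exact absurd hcount (by nlinarith)
  obtain ⟨w, hw⟩ : ∃ w, w ∉ A ∪ C := by
    by_contra hall
    push Not at hall
    have := Finset.card_union_of_disjoint hdisj
    rw [Finset.eq_univ_iff_forall.2 hall, Finset.card_univ] at this
    omega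
  rw [Finset.mem_union, not_or] at hw
  refine ⟨A, C, w, hAC.1, hAC.2, hdisj, hw.1, hw.2, ?_, fun u v => ⟨fun huv => ?_, ?_⟩⟩
  · intro z hz
    by_contra hzw
    have hz' : z ∉ insert w (A ∪ C) := by
      rw [Finset.mem_insert, not_or, Finset.mem_union, hAmem, hCmem]
      exact ⟨hzw, by omega⟩
    have := Finset.card_le_univ (insert z (insert w (A ∪ C)))
    rw [Finset.card_insert_of_notMem hz', Finset.card_insert_of_notMem (by simpa using hw),
      Finset.card_union_of_disjoint hdisj] at this
    omega
  · simpa only [hAmem, hCmem] using hM u v huv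
  · have hAC_adj : ∀ a ∈ A, ∀ c ∈ C, M.Adj a c := fun a ha c hc => by
      rw [← M.mem_neighborFinset,
        Finset.eq_of_subset_of_card_le (hNA a ha) (by rw [hNAcard a ha, hAC.2])]
      exact hc
    rintro (⟨hu, hv⟩ | ⟨hu, hv⟩)
    · exact hAC_adj u hu v hv
    · exact (hAC_adj v hv u hu).symm

end Bipartite

/-- A graph whose complement is `K_{C,A}` with one isolated vertex is `(K_C + K_A) ∨ K_1`. -/
lemma nonempty_iso_graphJoin_of_compl {V : Type*} [Fintype V] {G : SimpleGraph V} {k m : ℕ}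
    (hcard : Fintype.card V = m + k + 1) {A C : Finset V} {w : V} (hA : A.card = m)
    (hC : C.card = k) (hdisj : Disjoint A C) (hwA : w ∉ A) (hwC : w ∉ C)
    (hadj : ∀ u v, Gᶜ.Adj u v ↔ u ∈ A ∧ v ∈ C ∨ u ∈ C ∧ v ∈ A) :
    Nonempty (G ≃g graphJoin
      (SimpleGraph.completeGraph (Fin k) ⊕g SimpleGraph.completeGraph (Fin m))
      (SimpleGraph.completeGraph (Fin 1))) := by
  let eA : Fin m ≃ A := (finCongr hA.symm).trans A.equivFin.symm
  let eC : Fin k ≃ C := (finCongr hC.symm).trans C.equivFin.symm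
  have hG : ∀ u v, G.Adj u v ↔ u ≠ v ∧ ¬ (u ∈ A ∧ v ∈ C ∨ u ∈ C ∧ v ∈ A) := fun u v => by
    rw [← hadj, SimpleGraph.compl_adj]
    have := @SimpleGraph.Adj.ne _ G u v
    tauto
  have mA : ∀ i, (eA i : V) ∈ A := fun i => (eA i).2
  have mC : ∀ i, (eC i : V) ∈ C := fun i => (eC i).2
  have nA : ∀ i, (eC i : V) ∉ A := fun i h => Finset.disjoint_left.1 hdisj h (mC i)
  have nC : ∀ i, (eA i : V) ∉ C := fun i => Finset.disjoint_left.1 hdisj (mA i)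
  have neA : ∀ i, w ≠ eA i := fun i h => hwA (h ▸ mA i)
  have neC : ∀ i, w ≠ eC i := fun i h => hwC (h ▸ mC i)
  have neAC : ∀ i j, (eA i : V) ≠ eC j := fun i j h => nA j (h ▸ mA i)
  refine ⟨SimpleGraph.Iso.symm ⟨Equiv.ofBijective
    (Sum.elim (Sum.elim (fun i => (eC i : V)) fun i => (eA i : V)) fun _ => w) ?_, ?_⟩⟩
  · rw [Fintype.bijective_iff_injective_and_card]
    constructor
    · rintro ((a | a) | a) ((b | b) | b) h <;> simp only [Sum.elim_inl, Sum.elim_inr] at h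
      · rw [eC.injective (Subtype.ext h)]
      · exact (neAC b a h.symm).elim
      · exact (neC a h.symm).elim
      · exact (neAC a b h).elim
      · rw [eA.injective (Subtype.ext h)]
      · exact (neA a h.symm).elim
      · exact (neC b h).elim
      · exact (neA b h).elim
      · rw [Subsingleton.elim a b]
    · simp only [Fintype.card_sum, Fintype.card_fin]
      omega
  · rintro ((a | a) | a) ((b | b) | b) <;>
      simp [hG, graphJoin, SimpleGraph.completeGraph, mA, mC, nA, nC, neAC, (neAC _ _).symm, hwA,
        hwC, neA, neC, (neA _).symm, (neC _).symm]
    exact Subsingleton.elim a b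

/-! ### Traceability from every vertex and the spectral radius of the complement -/

theorem theorem2p13 {V : Type*} [Fintype V] [DecidableEq V] (G : SimpleGraph V)
    [DecidableRel G.Adj] (n k : ℕ) (hk : 2 ≤ k) (hcard : Fintype.card V = n)
    (hn : 2 * k + 1 ≤ n) (hdeg : k ≤ G.minDegree)
    (hspec : graphSpectralRadius Gᶜ ≤ Real.sqrt ((k : ℝ) * ((n : ℝ) - (k : ℝ) - 1))) :
    TraceableFromEveryVertex G ∨
      Nonempty (G ≃g graphJoin
        (SimpleGraph.completeGraph (Fin k) ⊕g SimpleGraph.completeGraph (Fin (n - k - 1)))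
        (SimpleGraph.completeGraph (Fin 1))) ∨
      (n = 2 * k + 1 ∧ IsEW n G) := by
  rw [or_iff_not_imp_left]
  intro hnot
  obtain ⟨x, hx⟩ := not_forall.1 hnot
  obtain ⟨M, _, hMG, hne, hsum⟩ := exists_le_compl_of_not_traceableFrom hx
  rw [hcard] at hsum
  have hGdeg : ∀ v, k ≤ G.degree v := fun v => hdeg.trans (G.minDegree_le_degree v)
  have hcompl : ∀ v, Gᶜ.degree v = n - 1 - G.degree v := fun v => hcard ▸ G.degree_compl (v := v)
  have hle : ∀ v, M.degree v ≤ Gᶜ.degree v := fun v => SimpleGraph.degree_le_of_le hMG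
  have hlt : ∀ v, G.degree v < n := fun v => hcard ▸ G.degree_lt_card_verts v
  rcases hn.eq_or_lt with hn' | hn'
  · refine .inr ⟨hn'.symm, ?_⟩
    have hdegM : ∀ u v, M.Adj u v → M.degree u = k := fun u v huv => by
      have := hsum u v huv
      have := hle u
      have := hle v
      have := hcompl u
      have := hcompl v
      have := hGdeg u
      have := hGdeg v
      omega
    have hmem : ∀ s, s ∈ Finset.univ.filter (fun v => M.degree v ≠ 0) ↔ M.degree s = k := by
      intro s
      simp only [Finset.mem_filter, Finset.mem_univ, true_and]
      refine ⟨fun h => ?_, fun h => by omega⟩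
      obtain ⟨v, hv⟩ := (M.degree_pos_iff_exists_adj s).1 (Nat.pos_of_ne_zero h)
      exact hdegM s v hv
    refine isEW_of_forall_degree_eq hcard hn'.symm (Finset.univ.filter fun v => M.degree v ≠ 0)
      ?_ (fun s hs => ?_) fun s hs t ht => ?_
    · obtain ⟨u, v, huv⟩ := hne
      rw [← hdegM u v huv, ← M.card_neighborFinset_eq_degree,
        ← Finset.card_insert_of_notMem (M.notMem_neighborFinset_self u)]
      refine Finset.card_le_card (Finset.insert_subset ?_ fun w hw => ?_)
      · exact (hmem u).2 (hdegM u v huv)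
      · exact (hmem w).2 (hdegM w u ((M.mem_neighborFinset u w).1 hw).symm)
    · rw [hmem] at hs
      have := hle s
      have := hcompl s
      have := hGdeg s
      omega
    · rw [hmem] at hs
      -- `s` already has full degree `k` in `M`, so no further non-neighbours in `G`.
      have heq : M.neighborFinset s = Gᶜ.neighborFinset s := by
        refine Finset.eq_of_subset_of_card_le (fun w hw => ?_) ?_
        · simp only [SimpleGraph.mem_neighborFinset] at hw ⊢
          exact hMG hw
        · rw [M.card_neighborFinset_eq_degree, Gᶜ.card_neighborFinset_eq_degree]
          have := hcompl s
          have := hGdeg s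
          omega
      by_contra hst
      have hst' : t ∈ Gᶜ.neighborFinset s := by
        rw [SimpleGraph.mem_neighborFinset, SimpleGraph.compl_adj]
        exact ⟨fun h => ht (h ▸ (hmem s).2 hs), hst⟩
      rw [← heq, M.mem_neighborFinset] at hst'
      exact ht ((hmem t).2 (hdegM t s hst'.symm))
  · left
    obtain ⟨m, rfl⟩ : ∃ m, n = m + k + 1 := ⟨n - k - 1, by omega⟩
    have hkm : k < m := by omega
    rw [show ((m + k + 1 : ℕ) : ℝ) - k - 1 = m by push_cast; ring, ← Nat.cast_mul] at hspec
    rw [show m + k + 1 - k - 1 = m by omega]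
    have hMm : ∀ v, M.degree v ≤ m := fun v => by
      have := hle v
      have := hcompl v
      have := hGdeg v
      omega
    -- `(m - d(u)) (m - d(v)) ≥ 0` and `d(u) + d(v) ≥ m + k` bound the product below by `k m`.
    have hprod : ∀ u v, M.Adj u v → k * m ≤ M.degree u * M.degree v := fun u v huv => by
      have h1 := hsum u v huv
      obtain ⟨a, ha⟩ := Nat.exists_eq_add_of_le (hMm u)
      obtain ⟨b, hb⟩ := Nat.exists_eq_add_of_le (hMm v)
      zify at ha hb h1 ⊢
      nlinarith [mul_nonneg (Int.natCast_nonneg a) (Int.natCast_nonneg b),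
        Int.natCast_nonneg m]
    obtain ⟨heq, hiso⟩ := sqrt_degree_mul_eq_of_graphSpectralRadius_le hMG hspec fun u v huv => by
      rw [← Real.sqrt_mul (Nat.cast_nonneg _), ← Nat.cast_mul]
      exact Real.sqrt_le_sqrt (by exact_mod_cast hprod u v huv)
    have hdegs : ∀ u v, M.Adj u v →
        M.degree u = k ∧ M.degree v = m ∨ M.degree u = m ∧ M.degree v = k := fun u v huv => by
      have h := heq u v huv
      rw [← Real.sqrt_mul (Nat.cast_nonneg _), ← Nat.cast_mul,
        Real.sqrt_inj (Nat.cast_nonneg _) (Nat.cast_nonneg _), Nat.cast_inj] at h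
      have h1 := hsum u v huv
      have hu := hMm u
      have hv := hMm v
      have h0 : (m - M.degree u) * (m - M.degree v) = 0 := by
        zify [hu, hv] at h h1 ⊢
        nlinarith [mul_nonneg (sub_nonneg.2 (Int.ofNat_le.2 hu)) (sub_nonneg.2 (Int.ofNat_le.2 hv)),
          Int.natCast_nonneg m]
      rcases Nat.mul_eq_zero.1 h0 with h0 | h0
      · have hum : M.degree u = m := by omega
        rw [hum, mul_comm] at h
        exact .inr ⟨hum, Nat.eq_of_mul_eq_mul_right (by omega) h⟩
      · have hvm : M.degree v = m := by omega
        rw [hvm] at h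
        exact .inl ⟨Nat.eq_of_mul_eq_mul_right (by omega) h, hvm⟩
    obtain ⟨A, C, w, hA, hC, hdisj, hwA, hwC, huniq, hadj⟩ :=
      exists_completeBipartite_of_degrees (by omega) hkm hcard hne hdegs
    refine nonempty_iso_graphJoin_of_compl hcard hA hC hdisj hwA hwC fun u v => ?_
    rw [← hadj]
    refine ⟨fun huv => ?_, fun h => hMG h⟩
    by_contra hM
    -- Both ends of such an edge are isolated in `M`, but `M` has only one isolated vertex.
    exact huv.ne ((huniq u (hiso u v huv hM)).trans
      (huniq v (hiso v u huv.symm fun h => hM h.symm)).symm)
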